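/- Let $n$ be a positive integer and let $G$ be a simple polyhedron of type $4_n$, i.e. a finite simple $3$-connected plane graph with $n$ vertices, all of degree $3$, each of whose faces is a $4$-gon or a $6$-gon. A zigzag of $G$ is a circuit of edges in which, on tracing it, one turns alternately to the left and to the right neighbouring edge (circuits that differ only by the starting point or the direction of tracing are the same zigzag). A railroad of $G$ is a circuit of hexagonal faces in which each hexagon is adjacent to its two neighbours in the circuit on opposite edges (a hexagon may occur more than once), and $G$ is called tight if it has no railroad. If $G$ is tight, then $G$ has at most $9$ zigzags. -/

import Mathlib

/-- A (finite, simple, connected) plane graph, given combinatorially: a simple graph together with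
the counter-clockwise cyclic order of the edges around each vertex (a rotation system), such that
the surface it defines is the sphere. A dart is an edge with a direction; `rot` sends a dart `d` to
the next dart, in counter-clockwise order, with the same initial vertex. The face to the left of
`d` is traced by following `d` and leaving its final vertex along the clockwise successor of
the reversed dart. The rotation system defines a sphere exactly when `V - E + F = 2`. -/
structure PlaneGraph (V : Type*) [Fintype V] where
  graph : SimpleGraph V
  rot : Equiv.Perm graph.Dart
  /-- Rotating a dart does not move its initial vertex. -/
  rot_fst : ∀ d, (rot d).fst = d.fst
  /-- All darts at a vertex form one cycle of the rotation. -/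
  rot_cycle : ∀ d d' : graph.Dart, d.fst = d'.fst → rot.SameCycle d d'
  connected : graph.Connected
  /-- The orbits of `d ↦ rot⁻¹ d.symm` are the faces. -/
  euler : (Fintype.card V : ℤ) - Nat.card graph.edgeSet
    + Nat.card (Quotient (Equiv.Perm.SameCycle.setoid
        (rot⁻¹ * SimpleGraph.Dart.symm_involutive.toPerm))) = 2

namespace PlaneGraph

variable {V : Type*} [Fintype V] (G : PlaneGraph V)

/-- Directed edges. -/
abbrev Dart : Type _ := G.graph.Dart

/-- The next dart on the boundary of the face to the left of a dart: `d ↦ rot⁻¹ d.symm`. -/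
def facePerm : Equiv.Perm G.Dart := G.rot⁻¹ * SimpleGraph.Dart.symm_involutive.toPerm

/-- The faces of a plane graph: closed boundary walks. -/
def Face : Type _ := Quotient (Equiv.Perm.SameCycle.setoid G.facePerm)

/-- The face to the left of a dart. -/
def leftFace (d : G.Dart) : G.Face := Quotient.mk (Equiv.Perm.SameCycle.setoid G.facePerm) d

/-- The number of sides of a face. -/
noncomputable def sides (f : G.Face) : ℕ := Nat.card {d : G.Dart // G.leftFace d = f}

/-- One step of a left-right path. In the state `(d, b)` the path runs along `d` and will continue
with the neighbour of `d` at its final vertex, on one side if `b = true` and on the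
other if `b = false`; the choices alternate. -/
def zigzagStep : Equiv.Perm (G.Dart × Bool) where
  toFun s := (if s.2 then G.rot s.1.symm else G.rot⁻¹ s.1.symm, !s.2)
  invFun s := (if s.2 then (G.rot s.1).symm else (G.rot⁻¹ s.1).symm, !s.2)
  left_inv := by rintro ⟨d, _ | _⟩ <;> simp
  right_inv := by rintro ⟨d, _ | _⟩ <;> simp

/-- The state at the same edge of the same left-right path traced backwards. -/
def zigzagReverse (s : G.Dart × Bool) : G.Dart × Bool := (s.1.symm, s.2)

lemma zigzagReverse_reverse (s : G.Dart × Bool) :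
    G.zigzagReverse (G.zigzagReverse s) = s := by
  simp [zigzagReverse]

lemma zigzagStep_reverse (s : G.Dart × Bool) :
    G.zigzagStep (G.zigzagReverse (G.zigzagStep s)) = G.zigzagReverse s := by
  rcases s with ⟨d, _ | _⟩ <;> simp [zigzagReverse, zigzagStep]

lemma zigzagReverse_step (s : G.Dart × Bool) :
    G.zigzagReverse (G.zigzagStep s) = G.zigzagStep⁻¹ (G.zigzagReverse s) := by
  rw [Equiv.Perm.eq_inv_iff_eq, zigzagStep_reverse]

lemma zigzagReverse_step_inv (s : G.Dart × Bool) :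
    G.zigzagReverse (G.zigzagStep⁻¹ s) = G.zigzagStep (G.zigzagReverse s) := by
  have h := G.zigzagStep_reverse (G.zigzagStep⁻¹ s)
  rw [← Equiv.Perm.mul_apply G.zigzagStep, mul_inv_cancel, Equiv.Perm.one_apply] at h
  exact h.symm

lemma sameCycle_zigzagReverse {s t : G.Dart × Bool} (h : G.zigzagStep.SameCycle s t) :
    G.zigzagStep.SameCycle (G.zigzagReverse s) (G.zigzagReverse t) := by
  obtain ⟨i, rfl⟩ := h
  refine ⟨-i, ?_⟩
  induction i with
  | zero => simp
  | succ n ih =>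
    rw [add_comm (n : ℤ) 1, zpow_one_add, Equiv.Perm.mul_apply, zigzagReverse_step, ← ih, neg_add,
      zpow_add, zpow_neg_one, Equiv.Perm.mul_apply]
  | pred n ih =>
    rw [sub_eq_add_neg, add_comm (-(n : ℤ)) (-1), zpow_add, zpow_neg_one, Equiv.Perm.mul_apply,
      zigzagReverse_step_inv, ← ih, neg_add, zpow_add, neg_neg, zpow_one, Equiv.Perm.mul_apply]

/-- Two states belong to the same (unoriented) closed left-right path. -/
def zigzagSetoid : Setoid (G.Dart × Bool) where
  r s t := G.zigzagStep.SameCycle s t ∨ G.zigzagStep.SameCycle s (G.zigzagReverse t)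
  iseqv :=
    { refl := fun s => Or.inl (Equiv.Perm.SameCycle.refl _ s)
      symm := by
        rintro s t (h | h)
        · exact Or.inl h.symm
        · have h' := G.sameCycle_zigzagReverse h.symm
          rw [zigzagReverse_reverse] at h'
          exact Or.inr h'
      trans := by
        rintro s t u (h | h) (k | k)
        · exact Or.inl (h.trans k)
        · exact Or.inr (h.trans k)
        · exact Or.inr (h.trans (G.sameCycle_zigzagReverse k))
        · have k' := G.sameCycle_zigzagReverse k
          rw [zigzagReverse_reverse] at k'
          exact Or.inl (h.trans k') }

/-- The zigzags of a plane graph: circuits of edges turning alternately left and right,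
where a circuit traced in either direction and from any starting point is the same zigzag. -/
def Zigzag : Type _ := Quotient G.zigzagSetoid

/-- A railroad: a circuit of hexagonal faces, each adjacent to its two neighbours in the circuit
on opposite edges. The `i`-th hexagon is the face to the left of `entry i`; the circuit
enters it through that edge and leaves it through the opposite one, three sides further along the
boundary, which, with the reverse direction, is the edge of entry of the next hexagon. Indices are
taken modulo the length; a face may occur more than once. -/
structure Railroad where
  length : ℕ
  length_pos : 0 < length
  entry : ZMod length → G.Dart
  hexagon : ∀ i, G.sides (G.leftFace (entry i)) = 6
  next : ∀ i, entry (i + 1) = ((G.facePerm ^ 3) (entry i)).symm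

/-- A plane graph is tight if it has no railroad. -/
def Tight : Prop := IsEmpty G.Railroad

/-- `G` is (the skeleton of) a polyhedron: it is 3-connected, i.e. it has more than three vertices
and stays connected when fewer than three vertices are deleted. -/
def IsPolyhedron : Prop :=
  3 < Fintype.card V ∧
    ∀ S : Finset V, S.card < 3 → (G.graph.induce {v | v ∉ S}).Connected

/-- Every vertex has degree 3. -/
def IsThreeValent : Prop := ∀ v, (G.graph.neighborSet v).ncard = 3

/-- `G` is a polyhedron `4_n`: it is 3-valent with `n` vertices, and all its faces are
4-gonal or 6-gonal. -/
structure IsFour (n : ℕ) : Prop where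
  card : Fintype.card V = n
  polyhedron : G.IsPolyhedron
  threeValent : G.IsThreeValent
  faces : ∀ f : G.Face, G.sides f = 4 ∨ G.sides f = 6

end PlaneGraph

/-! Two steps of a left-right path are conjugate to `crossing`, so each zigzag uses up two cycles of
`crossing`, one per direction (`two_mul_card_zigzag_le`). It remains to bound these cycles by 18.

A cycle avoiding the 4-gons would be a railroad, so by tightness every cycle contains one of the
darts bounding 4-gons; Euler's formula makes their number 24. Suppose a cycle contains only one of
them, `e`. All other faces it crosses are hexagons, and crossing them backwards joins the two sides
of the 4-gon adjacent to `e` (`sameCycle_crossing_facePerm`). Thus `facePerm e` is not alone on its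
cycle, and `facePerm` injects the lone darts into the others. At most 12 of the 24 are lone, which
leaves at most 12 + 12/2 = 18 cycles. -/

namespace Equiv.Perm

variable {α : Type*}

lemma card_sameCycle_eq_minimalPeriod (f : Equiv.Perm α) (x : α) :
    Nat.card {y // f.SameCycle y x} = Function.minimalPeriod f x := by
  have e : {y // f.SameCycle y x} ≃ MulAction.orbit (Subgroup.zpowers f) x := by
    refine Equiv.subtypeEquivRight fun y => ?_
    rw [Equiv.Perm.sameCycle_comm]
    constructor
    · rintro ⟨i, rfl⟩
      exact ⟨⟨f ^ i, i, rfl⟩, rfl⟩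
    · rintro ⟨⟨_, i, rfl⟩, rfl⟩
      exact ⟨i, rfl⟩
  rw [Nat.card_congr e, Nat.card_congr (MulAction.orbitZPowersEquiv f x), Nat.card_zmod]
  rfl

lemma pow_apply_eq_self_iff_dvd_card_sameCycle (f : Equiv.Perm α) (x : α) (m : ℕ) :
    (f ^ m) x = x ↔ Nat.card {y // f.SameCycle y x} ∣ m := by
  rw [card_sameCycle_eq_minimalPeriod, ← Function.isPeriodicPt_iff_minimalPeriod_dvd,
    Function.IsPeriodicPt, Function.IsFixedPt, Equiv.Perm.iterate_eq_pow]

end Equiv.Perm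

/-! ### Darts, faces and the permutations tracing them -/

namespace PlaneGraph

variable {V : Type*} [Fintype V] (G : PlaneGraph V)

instance : Finite G.Dart := by
  classical
  infer_instance

instance : Finite G.Face := Quotient.finite _

instance : Finite G.Zigzag := Quotient.finite _

/-- Reversal of darts, as a permutation. -/
def reversal : Equiv.Perm G.Dart := SimpleGraph.Dart.symm_involutive.toPerm

lemma reversal_ne (d : G.Dart) : G.reversal d ≠ d := d.symm_ne

lemma reversal_mul_self : G.reversal * G.reversal = 1 := by
  ext1 d
  exact d.symm_symm

lemma reversal_reversal (d : G.Dart) : G.reversal (G.reversal d) = d := d.symm_symm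

lemma facePerm_eq : G.facePerm = G.rot⁻¹ * G.reversal := rfl

/-- Crossing the face to the left of a dart: the third dart after it on the boundary, reversed. -/
def crossing : Equiv.Perm G.Dart := G.reversal * G.facePerm ^ 3

lemma crossing_apply (d : G.Dart) : G.crossing d = G.reversal ((G.facePerm ^ 3) d) := rfl

/-- Two steps of a left-right path, the first of them along the boundary of a left face. -/
def doubleStep : Equiv.Perm G.Dart := G.rot * G.reversal * G.facePerm

lemma sides_leftFace (d : G.Dart) :
    G.sides (G.leftFace d) = Nat.card {d' // G.facePerm.SameCycle d' d} :=
  Nat.card_congr (Equiv.subtypeEquivRight fun _ => Quotient.eq)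

lemma facePerm_pow_apply_eq_self_iff (d : G.Dart) (m : ℕ) :
    (G.facePerm ^ m) d = d ↔ G.sides (G.leftFace d) ∣ m := by
  rw [sides_leftFace, Equiv.Perm.pow_apply_eq_self_iff_dvd_card_sameCycle]

lemma leftFace_facePerm (d : G.Dart) : G.leftFace (G.facePerm d) = G.leftFace d :=
  Quotient.sound (Equiv.Perm.SameCycle.refl G.facePerm d).apply_left

lemma card_darts_at (v : V) :
    Nat.card {d : G.Dart // d.fst = v} = (G.graph.neighborSet v).ncard := by
  rw [← Nat.card_coe_set_eq]
  refine Nat.card_congr ⟨fun d => ⟨d.1.snd, ?_⟩, fun w => ⟨⟨(v, w.1), w.2⟩, rfl⟩, ?_, ?_⟩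
  · obtain ⟨d, rfl⟩ := d
    exact d.adj
  · rintro ⟨d, rfl⟩
    rfl
  · intro w
    rfl

variable {G}

lemma rot_zpow_fst (i : ℤ) (d : G.Dart) : ((G.rot ^ i) d).fst = d.fst := by
  induction i with
  | zero => simp
  | succ n ih => rw [add_comm, zpow_one_add, Equiv.Perm.mul_apply, G.rot_fst, ih]
  | pred n ih =>
    rw [← ih, ← G.rot_fst, ← Equiv.Perm.mul_apply, ← zpow_one_add, add_sub_cancel]

lemma IsThreeValent.rot_pow_three (h : G.IsThreeValent) : G.rot ^ 3 = 1 := by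
  ext1 d
  rw [Equiv.Perm.one_apply, Equiv.Perm.pow_apply_eq_self_iff_dvd_card_sameCycle,
    ← h d.fst, ← card_darts_at]
  refine (Nat.card_congr (Equiv.subtypeEquivRight fun d' => ⟨?_, G.rot_cycle d' d⟩)).dvd
  rintro ⟨i, rfl⟩
  exact (rot_zpow_fst i d').symm

/-! ### Counting darts by Euler's formula -/

lemma IsThreeValent.card_dart (h : G.IsThreeValent) : Nat.card G.Dart = 3 * Nat.card V := by
  have e := Nat.card_congr (Equiv.sigmaFiberEquiv fun d : G.Dart => d.fst)
  rw [← e, Nat.card_sigma]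
  simp [card_darts_at, h _, mul_comm]

variable (G) in
lemma card_dart_eq_two_mul_card_edgeSet : Nat.card G.Dart = 2 * Nat.card G.graph.edgeSet := by
  classical
  rw [Nat.card_eq_fintype_card, SimpleGraph.dart_card_eq_twice_card_edges,
    Nat.card_eq_fintype_card, SimpleGraph.edgeFinset_card]

variable (G) in
lemma card_dart_eq_sum_sides [Fintype G.Face] : Nat.card G.Dart = ∑ f, G.sides f := by
  rw [← Nat.card_congr (Equiv.sigmaFiberEquiv G.leftFace), Nat.card_sigma]
  rfl

variable (G) in
/-- The darts on the boundary of 4-gonal faces. -/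
def squareDarts : Set G.Dart := {d | G.sides (G.leftFace d) = 4}

lemma ncard_squareDarts {n : ℕ} (h : G.IsFour n) : G.squareDarts.ncard = 24 := by
  classical
  have := Fintype.ofFinite G.Face
  have hS : G.squareDarts.ncard = ∑ f, if G.sides f = 4 then 4 else 0 := by
    have e : (Σ f : G.Face, {d : G.squareDarts // G.leftFace d = f}) ≃ G.squareDarts :=
      Equiv.sigmaFiberEquiv fun d : G.squareDarts => G.leftFace d
    rw [← Nat.card_coe_set_eq, ← Nat.card_congr e, Nat.card_sigma]
    refine Finset.sum_congr rfl fun f _ => ?_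
    split_ifs with hf
    · rw [← hf]
      refine Nat.card_congr ⟨fun d => ⟨d.1.1, d.2⟩, fun d => ⟨⟨d.1, ?_⟩, d.2⟩, ?_, ?_⟩
      · simp only [squareDarts, Set.mem_ofPred_eq, d.2, hf]
      · intro d
        rfl
      · intro d
        rfl
    · have : IsEmpty {d : G.squareDarts // G.leftFace d = f} :=
        ⟨fun d => hf (d.2 ▸ d.1.2)⟩
      exact Nat.card_of_isEmpty
  -- Each face contributes 12: a 4-gon 4 + 2·4, a hexagon 0 + 2·6. With D darts, D = 3V = 2E turns
  -- Euler's formula into 12F = 24 + 2D.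
  have hsum : G.squareDarts.ncard + 2 * Nat.card G.Dart = 12 * Nat.card G.Face := by
    rw [hS, card_dart_eq_sum_sides, Finset.mul_sum, ← Finset.sum_add_distrib,
      Finset.sum_congr rfl (g := fun _ => 12), Finset.sum_const, Finset.card_univ,
      Nat.card_eq_fintype_card, smul_eq_mul, mul_comm]
    intro f _
    rcases h.faces f with hf | hf <;> simp [hf]
  have hV := h.threeValent.card_dart
  have hE := G.card_dart_eq_two_mul_card_edgeSet
  have heuler : (Fintype.card V : ℤ) - Nat.card G.graph.edgeSet + Nat.card G.Face = 2 := G.euler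
  rw [Nat.card_eq_fintype_card (α := V)] at hV
  omega

/-! ### Zigzags and cycles of `crossing` -/

/-- At a vertex of degree 3, one counter-clockwise turn equals two clockwise ones, and clockwise
turns are expressible by `facePerm` and `reversal`. -/
lemma IsThreeValent.doubleStep_eq (h : G.IsThreeValent) :
    G.doubleStep = G.facePerm * G.crossing * G.facePerm⁻¹ := by
  have h2 : G.rot⁻¹ * G.rot⁻¹ = G.rot := by
    rw [← mul_inv_rev, inv_eq_iff_mul_eq_one, ← h.rot_pow_three, pow_succ, pow_two]
  have h1 : G.rot⁻¹ = G.facePerm * G.reversal := by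
    rw [facePerm_eq, mul_assoc, reversal_mul_self, mul_one]
  calc G.doubleStep = G.rot⁻¹ * (G.rot⁻¹ * G.reversal) * G.facePerm := by
        rw [← mul_assoc, h2]; rfl
    _ = G.facePerm * G.reversal * G.facePerm * G.facePerm := by rw [← facePerm_eq, h1]
    _ = G.facePerm * G.crossing * G.facePerm⁻¹ := by
        simp only [crossing, mul_assoc, pow_three, mul_inv_cancel, mul_one]

variable (G) in
lemma reversal_doubleStep : G.reversal * G.doubleStep * G.reversal⁻¹ = G.doubleStep⁻¹ := by
  have hinv : G.reversal⁻¹ = G.reversal := inv_eq_of_mul_eq_one_left G.reversal_mul_self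
  rw [doubleStep, facePerm_eq]
  simp only [mul_inv_rev, inv_inv, hinv]
  simp only [mul_assoc, reversal_mul_self, mul_one]

variable (G) in
-- Since `reversal` inverts `doubleStep` by conjugation, it would reflect the common cycle, hence
-- fix some dart `x` or send some `x` to its successor. In the latter case it fixes `facePerm x`;
-- but it fixes no dart.
lemma not_sameCycle_doubleStep_reversal (d : G.Dart) :
    ¬ G.doubleStep.SameCycle d (G.reversal d) := by
  rintro ⟨k, hk⟩
  have hrev (j : ℤ) (x : G.Dart) :
      G.reversal ((G.doubleStep ^ j) x) = (G.doubleStep ^ (-j)) (G.reversal x) := by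
    rw [zpow_neg, ← inv_zpow, ← reversal_doubleStep, conj_zpow]
    simp
  obtain ⟨j, rfl | rfl⟩ := Int.even_or_odd' k
  · apply G.reversal_ne ((G.doubleStep ^ j) d)
    rw [hrev, ← hk, ← Equiv.Perm.mul_apply, ← zpow_add]
    congr 2
    ring
  · have hx : G.reversal ((G.doubleStep ^ j) d) = G.doubleStep ((G.doubleStep ^ j) d) := by
      rw [hrev, ← hk, ← Equiv.Perm.mul_apply, ← zpow_add, ← Equiv.Perm.mul_apply, ← zpow_one_add]
      congr 2
      ring
    generalize (G.doubleStep ^ j) d = x at hx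
    apply G.reversal_ne (G.facePerm x)
    rw [doubleStep, Equiv.Perm.mul_apply, Equiv.Perm.mul_apply] at hx
    apply G.rot.injective
    rw [← hx, facePerm_eq]
    simp

variable (G) in
lemma zigzagStep_zigzagStep (d : G.Dart) :
    G.zigzagStep (G.zigzagStep (d, false)) = (G.doubleStep d, false) := rfl

lemma sameCycle_zigzagStep_of_doubleStep {d d' : G.Dart} (h : G.doubleStep.SameCycle d d') :
    G.zigzagStep.SameCycle (d, false) (d', false) := by
  obtain ⟨i, rfl⟩ := h.exists_nat_pow_eq
  induction i with
  | zero => exact Equiv.Perm.SameCycle.refl _ _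
  | succ i ih =>
    rw [pow_succ', Equiv.Perm.mul_apply, ← zigzagStep_zigzagStep]
    exact (ih ⟨i, by simp⟩).apply_right.apply_right

/-- Cycles of a permutation. -/
abbrev Cycles {α : Type*} (f : Equiv.Perm α) : Type _ := Quotient (Equiv.Perm.SameCycle.setoid f)

variable (G) in
/-- The zigzag that runs along a dart and continues along the face to its left. -/
def zigzagOf (d : G.Dart) : G.Zigzag := Quotient.mk G.zigzagSetoid (d, false)

variable (G) in
lemma zigzagOf_surjective : Function.Surjective G.zigzagOf := by
  intro z
  induction z using Quotient.inductionOn with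
  | _ s =>
    obtain ⟨d, _ | _⟩ := s
    · exact ⟨d, rfl⟩
    · exact ⟨G.rot d.symm,
        Quotient.sound (Or.inl (Equiv.Perm.SameCycle.refl G.zigzagStep (d, true)).apply_left)⟩

lemma IsThreeValent.two_mul_card_zigzag_le (h : G.IsThreeValent) :
    2 * Nat.card G.Zigzag ≤ Nat.card (Cycles G.crossing) := by
  choose r hr using G.zigzagOf_surjective
  have hcyc {d d' : G.Dart} (hd : (Quotient.mk _ (G.facePerm⁻¹ d) : Cycles G.crossing)
      = Quotient.mk _ (G.facePerm⁻¹ d')) : G.doubleStep.SameCycle d d' := by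
    rw [h.doubleStep_eq, Equiv.Perm.sameCycle_conj]
    exact Quotient.exact hd
  have hz {d d' : G.Dart} (hd : G.doubleStep.SameCycle d d') :
      G.zigzagOf d = G.zigzagOf d' :=
    Quotient.sound (Or.inl (sameCycle_zigzagStep_of_doubleStep hd))
  have hrev (d : G.Dart) : G.zigzagOf (G.reversal d) = G.zigzagOf d :=
    Quotient.sound (Or.inr (Equiv.Perm.SameCycle.refl _ _))
  -- The `Bool` chooses the direction of the zigzag; `facePerm⁻¹` undoes the conjugation between
  -- `doubleStep` and `crossing`.
  let F : Bool × G.Zigzag → Cycles G.crossing := fun p =>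
    Quotient.mk _ (G.facePerm⁻¹ (if p.1 then r p.2 else G.reversal (r p.2)))
  have hF : Function.Injective F := by
    rintro ⟨b, z⟩ ⟨b', z'⟩ hzz
    have hs := hcyc hzz
    have hz' := hz hs
    have hzeq : z = z' := by
      rw [← hr z, ← hr z']
      cases b <;> cases b' <;> simpa only [hrev, Bool.false_eq_true, if_true, if_false] using hz'
    subst hzeq
    cases b <;> cases b'
    · rfl
    · exact (G.not_sameCycle_doubleStep_reversal _ hs.symm).elim
    · exact (G.not_sameCycle_doubleStep_reversal _ hs).elim
    · rfl
  have := Nat.card_le_card_of_injective F hF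
  simpa [Nat.card_prod] using this

/-! ### Tightness and the number of cycles of `crossing` -/

lemma exists_mem_squareDarts_of_tight {n : ℕ} (h : G.IsFour n) (ht : G.Tight) (d : G.Dart) :
    ∃ e ∈ G.squareDarts, G.crossing.SameCycle d e := by
  by_contra! hne
  have hpos : 0 < orderOf G.crossing := orderOf_pos _
  have : NeZero (orderOf G.crossing) := ⟨hpos.ne'⟩
  -- The order of `crossing` is a multiple of the cycle length, so this railroad closes up, perhaps
  -- after several rounds.
  refine ht.false ⟨orderOf G.crossing, hpos, fun i => (G.crossing ^ i.val) d, fun i => ?_,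
    fun i => ?_⟩
  · refine (h.faces _).resolve_left fun h4 => hne _ h4 ⟨(i.val : ℕ), ?_⟩
    rw [zpow_natCast]
  · have : G.crossing ^ (i + 1).val = G.crossing ^ (i.val + 1) := by
      rw [pow_eq_pow_iff_modEq, ← ZMod.natCast_eq_natCast_iff]
      simp
    rw [this, pow_succ', Equiv.Perm.mul_apply]
    rfl

/-- A crossing cycle that meets only one corner of a 4-gon forces the two neighbouring
corners of this 4-gon onto a common crossing cycle. -/
lemma sameCycle_crossing_facePerm {n : ℕ} (h : G.IsFour n) {e : G.Dart} (he : e ∈ G.squareDarts)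
    (huniq : ∀ x ∈ G.squareDarts, G.crossing.SameCycle e x → x = e) :
    G.crossing.SameCycle (G.facePerm e) ((G.facePerm ^ 3) e) := by
  have key (j : ℕ) : G.crossing.SameCycle (G.reversal (G.crossing e))
      (G.reversal ((G.crossing ^ (j + 1)) e)) := by
    induction j with
    | zero => exact Equiv.Perm.SameCycle.refl _ _
    | succ j ih =>
      rw [pow_succ' _ (j + 1), Equiv.Perm.mul_apply]
      have hx : G.crossing.SameCycle e ((G.crossing ^ (j + 1)) e) :=
        ⟨(j + 1 : ℕ), by rw [zpow_natCast]⟩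
      generalize (G.crossing ^ (j + 1)) e = x at ih hx
      -- At a 4-gon the path is back at `e` and the claim restarts. In a hexagon, `reversal
      -- (crossing x)` is the side opposite to `x`, so crossing from it leads back to `reversal x`.
      rcases h.faces (G.leftFace x) with h4 | h6
      · rw [huniq x h4 hx]
      · have hxx : G.crossing (G.reversal (G.crossing x)) = G.reversal x := by
          rw [crossing_apply G x, reversal_reversal, crossing_apply,
            ← Equiv.Perm.mul_apply (G.facePerm ^ 3), ← pow_add, (G.facePerm_pow_apply_eq_self_iff x (3 + 3)).2 (by rw [h6])]
        rw [← hxx] at ih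
        exact Equiv.Perm.sameCycle_apply_right.1 ih
  have h4 : (G.facePerm ^ 4) e = e :=
    (G.facePerm_pow_apply_eq_self_iff e 4).2 (by rw [show G.sides (G.leftFace e) = 4 from he])
  have hlast := key (orderOf G.crossing - 1)
  rw [Nat.sub_add_cancel (orderOf_pos G.crossing), pow_orderOf_eq_one, Equiv.Perm.one_apply,
    crossing_apply, reversal_reversal] at hlast
  have he' : G.crossing (G.facePerm e) = G.reversal e := by
    rw [crossing_apply, ← Equiv.Perm.mul_apply (G.facePerm ^ 3), ← pow_succ, h4]
  rw [← he'] at hlast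
  exact (Equiv.Perm.sameCycle_apply_right.1 hlast).symm

lemma facePerm_mem_squareDarts {e : G.Dart} (he : e ∈ G.squareDarts) :
    G.facePerm e ∈ G.squareDarts := by
  rw [squareDarts, Set.mem_ofPred_eq, leftFace_facePerm]
  exact he

lemma facePerm_pow_three_ne {e : G.Dart} (he : e ∈ G.squareDarts) :
    (G.facePerm ^ 3) e ≠ G.facePerm e := by
  intro h
  rw [pow_succ', Equiv.Perm.mul_apply] at h
  have h2 := (G.facePerm_pow_apply_eq_self_iff e 2).1 (G.facePerm.injective h)
  rw [show G.sides (G.leftFace e) = 4 from he] at h2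
  omega

/-- If `s` meets every fibre of `p`, then twice the number of fibres is at most the size of `s` plus
the number of elements of `s` that are alone in their fibre. -/
lemma two_mul_card_le_of_surjOn {α β : Type*} [Fintype α] [Fintype β] [DecidableEq α]
    [DecidableEq β] (p : α → β) (s : Finset α) (hs : ∀ b, ∃ a ∈ s, p a = b) :
    2 * Fintype.card β ≤ s.card + (s.filter fun a => ∀ x ∈ s, p x = p a → x = a).card := by
  rw [← Finset.card_univ, Finset.card_eq_sum_card_fiberwise (s := s) (t := Finset.univ) (f := p)
      (fun _ _ => Finset.mem_coe.2 (Finset.mem_univ _)),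
    Finset.card_eq_sum_card_fiberwise (s := s.filter _) (t := Finset.univ) (f := p)
      (fun _ _ => Finset.mem_coe.2 (Finset.mem_univ _)), ← Finset.sum_add_distrib, mul_comm,
    ← smul_eq_mul]
  refine Finset.card_nsmul_le_sum _ _ _ fun b _ => ?_
  obtain ⟨a, ha, rfl⟩ := hs b
  -- A lone element is counted in both terms; any other fibre has two elements in `s`.
  by_cases hu : ∀ x ∈ s, p x = p a → x = a
  · have h1 : 0 < (s.filter fun x => p x = p a).card := Finset.card_pos.2 ⟨a, by simp [ha]⟩
    have h2 : 0 < ((s.filter fun a => ∀ x ∈ s, p x = p a → x = a).filter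
        fun x => p x = p a).card :=
      Finset.card_pos.2 ⟨a, Finset.mem_filter.2 ⟨Finset.mem_filter.2 ⟨ha, hu⟩, rfl⟩⟩
    omega
  · push Not at hu
    obtain ⟨x, hx, hxa, hne⟩ := hu
    have : 1 < (s.filter fun x => p x = p a).card :=
      Finset.one_lt_card.2 ⟨x, by simp [hx, hxa], a, by simp [ha], hne⟩
    omega

lemma card_cycles_crossing_le {n : ℕ} (h : G.IsFour n) (ht : G.Tight) :
    Nat.card (Cycles G.crossing) ≤ 18 := by
  classical
  have := Fintype.ofFinite (Cycles G.crossing)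
  let p : G.Dart → Cycles G.crossing := Quotient.mk _
  have hp {x y : G.Dart} : p x = p y ↔ G.crossing.SameCycle x y := Quotient.eq
  let s : Finset G.Dart := G.squareDarts.toFinset
  have hs {x : G.Dart} : x ∈ s ↔ x ∈ G.squareDarts := Set.mem_toFinset
  have hcard : s.card = 24 := by rw [← ncard_squareDarts h, Set.ncard_eq_toFinset_card']
  set u := s.filter fun a => ∀ x ∈ s, p x = p a → x = a with hu
  have hle : 2 * Fintype.card (Cycles G.crossing) ≤ s.card + u.card := by
    convert two_mul_card_le_of_surjOn p s fun c => ?_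
    obtain ⟨d, rfl⟩ := Quotient.exists_rep c
    obtain ⟨e, he, hde⟩ := exists_mem_squareDarts_of_tight h ht d
    exact ⟨e, hs.2 he, hp.2 hde.symm⟩
  have hlone : u.card ≤ (s \ u).card := by
    refine Finset.card_le_card_of_injOn G.facePerm (fun e he => ?_) G.facePerm.injective.injOn
    rw [Finset.mem_coe, hu, Finset.mem_filter] at he
    have hes := hs.1 he.1
    rw [Finset.mem_coe, Finset.mem_sdiff, hu, Finset.mem_filter]
    refine ⟨hs.2 (facePerm_mem_squareDarts hes), fun hf => facePerm_pow_three_ne hes ?_⟩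
    refine hf.2 _ (hs.2 ?_) (hp.2 ?_)
    · exact facePerm_mem_squareDarts (facePerm_mem_squareDarts (facePerm_mem_squareDarts hes))
    · exact (sameCycle_crossing_facePerm h hes fun x hx hex =>
        he.2 x (hs.2 hx) (hp.2 hex.symm)).symm
  have hsplit : (s \ u).card + u.card = s.card :=
    Finset.card_sdiff_add_card_eq_card (Finset.filter_subset _ s)
  rw [Nat.card_eq_fintype_card]
  omega

end PlaneGraph

theorem theorem6p3 {V : Type*} [Fintype V] (G : PlaneGraph V) (n : ℕ)
    (hG : G.IsFour n) (htight : G.Tight) :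
    Finite G.Zigzag ∧ Nat.card G.Zigzag ≤ 9 := by
  refine ⟨inferInstance, ?_⟩
  have h1 := hG.threeValent.two_mul_card_zigzag_le
  have h2 := PlaneGraph.card_cycles_crossing_le hG htight
  omega
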